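/- Let $S$ and $A$ be the finite state and action sets of a Markov decision process with transition model $P(x'\mid x,a)$ and some initial state distribution. For a stationary (possibly randomized) policy $\pi$ let $P(\pi)_{x,x'}=\sum_{a}\pi(a\mid x)P(x'\mid x,a)$. Assume the mixing condition with a constant $\tau\ge \tfrac12$: for every policy $\pi$ and all distributions $d,d'$ on $S$, $\|dP(\pi)-d'P(\pi)\|_1\le e^{-1/\tau}\|d-d'\|_1$. Let $d_\pi$ be the stationary distribution of $\pi$ on state-action pairs, i.e. the limit of the law of (state, action) at time $t$ under $\pi$ as $t\to\infty$, and for $l\in\mathbb{R}^{S\times A}$ put $\langle l,d\rangle=\sum_{x,a}l(x,a)d(x,a)$ and $$Q_{\pi,l}(s,a)=\mathbb{E}\Big[\sum_{t=1}^{\infty}\big(l(s_t,a_t)-\langle l,d_\pi\rangle\big)\,\Big|\,s_1=s,\ a_1=a,\ \pi\Big].$$ Let $\Delta_L$ be the set of convex combinations of given loss vectors $l_1,\dots,l_L\in[0,1]^{S\times A}$. An adversary chooses in each round $t$ a loss in $\Delta_L$ as a function of the agent's previous policies $\pi_1,\dots,\pi_{t-1}$; write $l_t^{\pi_t}$ for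 its choice in round $t$ when the agent plays $\pi_1,\pi_2,\dots$, and $l_t^{\pi}$ for its choice in round $t$ when the agent plays the fixed policy $\pi$ in all rounds. Fix a horizon $T$ and assume that the adversary's external regret with respect to stationary distributions satisfies, for every sequence of policies $\pi_1,\pi_2,\dots$, $$\max_{l\in\Delta_L}\Big(\sum_{t=1}^T\langle l,d_{\pi_t}\rangle-\sum_{t=1}^T\langle l_t^{\pi_t},d_{\pi_t}\rangle\Big)\le\sqrt{\frac{T\log L}{2}} .$$ Suppose the agent follows MDP-Expert (MDP-E): it runs in each state $s$ the Multiplicative Weights Update over the actions with feedback $Q_{\pi_t,l_t}(s,\cdot)$, where $l_t=l_t^{\pi_t}$, that is, $\pi_1(\cdot\mid s)$ is uniform on $A$ and $$\pi_{t+1}(a\mid s)=\frac{\pi_t(a\mid s)\,e^{-\mu Q_{\pi_t,l_t}(s,a)}}{\sum_{b\in A}\pi_t(b\mid s)\,e^{-\mu Q_{\pi_t,l_t}(s,b)}},\qquad \mu=\frac{1}{3\tau}\sqrt{\frac{8\log|A|}{T}} .$$ Then for every stationary policy $\pi$, $$\sum_{t=1}^T\big\langle l_t^{\pi_t},d_{\pi_t}\big\rangle-\sum_{t=1}^T\big\langle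 l_t^{\pi},d_{\pi}\big\rangle\le\sqrt{\frac{T\log L}{2}}+3\tau\sqrt{\frac{T\log|A|}{2}} .$$ -/

import Mathlib

open Filter

noncomputable section

namespace OMDP

/-- A finite Markov decision process without losses: a transition model `P(x' | x, a)` and an
initial state distribution. -/
structure MDP (S A : Type*) [Fintype S] where
  /-- `trans x a x'` is `P(x' | x, a)`. -/
  trans : S → A → S → ℝ
  /-- the distribution of the initial state -/
  init : S → ℝ
  trans_mem : ∀ x a, trans x a ∈ stdSimplex ℝ S
  init_mem : init ∈ stdSimplex ℝ S

/-- A stationary (possibly randomized) policy; `prob x a` is `π(a | x)`. -/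
structure Policy (S A : Type*) [Fintype A] where
  prob : S → A → ℝ
  prob_mem : ∀ x, prob x ∈ stdSimplex ℝ A

variable {S A : Type*} [Fintype S] [Fintype A]

/-- The pairing `⟨l, d⟩` of vectors indexed by state-action pairs. -/
def pairing (l d : S → A → ℝ) : ℝ := ∑ x, ∑ a, l x a * d x a

/-- The `ℓ¹` norm of a vector indexed by states. -/
def l1Norm (d : S → ℝ) : ℝ := ∑ x, |d x|

/-- The state transition matrix `P(π)` induced by a policy. -/
def MDP.transMatrix (M : MDP S A) (π : Policy S A) : Matrix S S ℝ :=
  Matrix.of fun x x' => ∑ a, π.prob x a * M.trans x a x'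

/-- The mixing time assumption with constant `τ`. -/
def MDP.Mixing (M : MDP S A) (τ : ℝ) : Prop :=
  ∀ d ∈ stdSimplex ℝ S, ∀ d' ∈ stdSimplex ℝ S, ∀ π : Policy S A,
    l1Norm (Matrix.vecMul d (M.transMatrix π) - Matrix.vecMul d' (M.transMatrix π))
      ≤ Real.exp (-1 / τ) * l1Norm (d - d')

/-- The law of the state-action pair after `n` steps, when the first pair has law `v` and all
later actions are drawn from `π`. -/
def MDP.law (M : MDP S A) (π : Policy S A) (v : S → A → ℝ) : ℕ → S → A → ℝ
  | 0 => v
  | n + 1 => fun x' a' => (∑ x, ∑ a, M.law π v n x a * M.trans x a x') * π.prob x' a'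

/-- The law of the state-action pair at round `n + 1` when `π` is followed throughout, starting
from the initial state distribution. -/
def MDP.occupancy (M : MDP S A) (π : Policy S A) : ℕ → S → A → ℝ :=
  M.law π fun x a => M.init x * π.prob x a

/-- The stationary state-action distribution `d_π`: the limit of the law of the state-action
pair at round `n`. Under the mixing assumption this limit exists and does not depend on the
initial distribution. -/
def MDP.stationary (M : MDP S A) (π : Policy S A) (x : S) (a : A) : ℝ :=
  limUnder atTop fun n => M.occupancy π n x a

/-- The average loss `η_l(π) = ⟨l, d_π⟩`. -/
def MDP.avgLoss (M : MDP S A) (π : Policy S A) (l : S → A → ℝ) : ℝ :=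
  pairing l (M.stationary π)

open Classical in
/-- The accumulated loss `Q_{π,l}(s,a) = E[∑_{t ≥ 1} (l(s_t,a_t) - η_l(π)) | s_1 = s, a_1 = a, π]`.
Under the mixing assumption the series of expectations converges absolutely. -/
def MDP.Q (M : MDP S A) (π : Policy S A) (l : S → A → ℝ) (s : S) (a : A) : ℝ :=
  ∑' n : ℕ, (pairing l (M.law π (fun x b => if x = s ∧ b = a then 1 else 0) n) - M.avgLoss π l)

/-- `Δ_L`: all convex combinations of the loss vectors `ℓ 0, …, ℓ (L - 1)`. -/
def lossSimplex {L : ℕ} (ℓ : Fin L → S → A → ℝ) : Set (S → A → ℝ) :=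
  {l | ∃ w ∈ stdSimplex ℝ (Fin L), l = fun x a => ∑ i, w i * ℓ i x a}

/-- An adaptive adversary: at each round it chooses an element of `Δ_L` as a function of all the
policies that the agent has used in the earlier rounds. -/
structure Adversary {L : ℕ} (ℓ : Fin L → S → A → ℝ) where
  respond : (t : ℕ) → (Fin t → Policy S A) → S → A → ℝ
  respond_mem : ∀ t h, respond t h ∈ lossSimplex ℓ

/-- The loss that the adversary plays in round `t + 1` when the agent plays the policies
`π 0, π 1, …` in rounds `1, 2, …`. -/
def Adversary.loss {L : ℕ} {ℓ : Fin L → S → A → ℝ} (adv : Adversary ℓ) (π : ℕ → Policy S A)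
    (t : ℕ) : S → A → ℝ :=
  adv.respond t fun i => π i

/-- Over `T` rounds the adversary's external regret, measured through the stationary
distributions of the agent's policies, is at most `√(T log L / 2)` for every sequence of
policies of the agent. -/
def Adversary.NoExternalRegret {L : ℕ} {ℓ : Fin L → S → A → ℝ} (adv : Adversary ℓ)
    (M : MDP S A) (T : ℕ) : Prop :=
  ∀ π : ℕ → Policy S A, ∀ l ∈ lossSimplex ℓ,
    ∑ t ∈ Finset.range T, pairing l (M.stationary (π t))
      - ∑ t ∈ Finset.range T, pairing (adv.loss π t) (M.stationary (π t))
      ≤ Real.sqrt (T * Real.log L / 2)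

/-- One step of Multiplicative Weights Update with learning rate `μ` and feedback `k`. -/
def mwuStep (μ : ℝ) (p k : A → ℝ) (a : A) : ℝ :=
  p a * Real.exp (-μ * k a) / ∑ b, p b * Real.exp (-μ * k b)

/-- The agent's policies `π 0, π 1, …` (rounds `1, 2, …`) are those of MDP-Expert against the
adversary: in each state `s`, Multiplicative Weights Update over the actions, with constant
learning rate `μ`, starts from the uniform distribution and receives in each round `t` the
feedback `Q_{π_t, l_t}(s, ·)`. -/
def FollowsMDPE {L : ℕ} {ℓ : Fin L → S → A → ℝ} (M : MDP S A) (adv : Adversary ℓ) (μ : ℝ)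
    (π : ℕ → Policy S A) : Prop :=
  (∀ s a, (π 0).prob s a = 1 / Fintype.card A) ∧
    ∀ t s, (π (t + 1)).prob s = mwuStep μ ((π t).prob s) (M.Q (π t) (adv.loss π t) s)

/-- The learning rate of Multiplicative Weights Update tuned to `n` experts, horizon `T` and
feedback of range `R`. -/
def mwuRate (n T : ℕ) (R : ℝ) : ℝ := Real.sqrt (8 * Real.log n / T) / R

end OMDP

end

/-!
Multiplicative Weights controls, in every state `s`, the regret of `π_t(· | s)` against any mixed
action for the feedback `Q_{π_t, l_t}(s, ·)`. The performance difference identity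
`η_l(π) - η_l(π') = ∑ s, d_π'(s) * (π(· | s) - π'(· | s)) ⬝ Q_{π,l}(s, ·)` averages these local
regrets into the regret against a fixed policy in terms of stationary losses. With
`q = e^{-1/τ}`, the feedback has range at most `(1 + q) / (1 - q)`, which is at most `3τ` for
`τ ≥ 1/2`: the rows `P(· | s, a)` and `P(· | s', b)` of two distinct states belong to the transition
matrix of one policy, so mixing makes them `2q`-close in `ℓ¹`; through the row of another state,
`P(· | s, a)` and `P(· | s, b)` are `4q`-close, and the effect of the first action on the later
losses decays like `q^n`. Finally, by its own regret bound the adversary gains at most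
`√(T log L / 2)` when it replaces the losses it plays against the fixed comparator by `l_t`.
-/

open Matrix Topology

namespace OMDP

section MultiplicativeWeights

variable {A : Type*} [Fintype A]

theorem sum_mul_exp_pos {p : A → ℝ} (hp : p ∈ stdSimplex ℝ A) (f : A → ℝ) :
    0 < ∑ a, p a * Real.exp (f a) :=
  (convex_Ioi (0 : ℝ)).sum_mem (fun a _ => hp.1 a) hp.2 fun _ _ => Real.exp_pos _

open MeasureTheory ProbabilityTheory in
theorem log_sum_mul_exp_le {p k : A → ℝ} {R : ℝ} (hp : p ∈ stdSimplex ℝ A)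
    (hk : ∀ a b, k a - k b ≤ R) (t : ℝ) :
    Real.log (∑ a, p a * Real.exp (t * k a)) ≤ t * (p ⬝ᵥ k) + t ^ 2 * R ^ 2 / 8 := by
  have : Nonempty A := by
    by_contra h
    rw [not_nonempty_iff] at h
    simpa using hp.2
  obtain ⟨b, hb⟩ := Finite.exists_min k
  have hR : 0 ≤ R := by simpa using hk b b
  let _ : MeasurableSpace A := ⊤
  let P : PMF A := PMF.ofFintype (fun a => ENNReal.ofReal (p a)) (by
    rw [← ENNReal.ofReal_sum_of_nonneg fun a _ => hp.1 a, hp.2, ENNReal.ofReal_one])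
  have integral_eq (f : A → ℝ) : ∫ a, f a ∂P.toMeasure = p ⬝ᵥ f := by
    simp [PMF.integral_eq_sum, P, hp.1, dotProduct]
  have hoeffding := (hasSubgaussianMGF_of_mem_Icc (μ := P.toMeasure) (X := k)
    (a := k b) (b := k b + R) measurable_from_top.aemeasurable
    (ae_of_all _ fun a => ⟨hb a, by linarith [hk a b]⟩)).cgf_le t
  have hcenter : ∑ a, p a * Real.exp (t * (k a - p ⬝ᵥ k))
      = (∑ a, p a * Real.exp (t * k a)) * Real.exp (-(t * (p ⬝ᵥ k))) := by
    simp_rw [Finset.sum_mul, mul_assoc, ← Real.exp_add, mul_sub, sub_eq_add_neg]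
  rw [cgf, mgf, integral_eq, integral_eq, dotProduct, hcenter, Real.log_mul
    (sum_mul_exp_pos hp _).ne' (Real.exp_pos _).ne', Real.log_exp, add_sub_cancel_left] at hoeffding
  simp only [NNReal.coe_pow, NNReal.coe_div, coe_nnnorm, NNReal.coe_ofNat, Real.norm_eq_abs,
    abs_of_nonneg hR] at hoeffding
  linarith

theorem mwuStep_mem_stdSimplex {p : A → ℝ} (hp : p ∈ stdSimplex ℝ A) (μ : ℝ) (k : A → ℝ) :
    mwuStep μ p k ∈ stdSimplex ℝ A := by
  have hZ := sum_mul_exp_pos hp fun b => -μ * k b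
  refine ⟨fun a => div_nonneg (mul_nonneg (hp.1 a) (Real.exp_pos _).le) hZ.le, ?_⟩
  simp only [mwuStep]
  rw [← Finset.sum_div, div_self hZ.ne']

theorem mwuStep_pos {p : A → ℝ} (hp : p ∈ stdSimplex ℝ A) (μ : ℝ) (k : A → ℝ) {a : A}
    (ha : 0 < p a) : 0 < mwuStep μ p k a :=
  div_pos (mul_pos ha (Real.exp_pos _)) (sum_mul_exp_pos hp _)

theorem mul_dotProduct_sub_le_log_mwuStep {p k : A → ℝ} {R : ℝ} (hp : p ∈ stdSimplex ℝ A)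
    (hk : ∀ a b, k a - k b ≤ R) (μ : ℝ) {a : A} (ha : 0 < p a) :
    μ * (p ⬝ᵥ k - k a) ≤ Real.log (mwuStep μ p k a) - Real.log (p a) + μ ^ 2 * R ^ 2 / 8 := by
  have hlog := log_sum_mul_exp_le hp hk (-μ)
  rw [mwuStep, Real.log_div (by positivity) (sum_mul_exp_pos hp _).ne',
    Real.log_mul ha.ne' (Real.exp_pos _).ne', Real.log_exp]
  linarith

theorem mul_sum_mwu_regret_le {p k : ℕ → A → ℝ} {R μ : ℝ} (hp : p 0 ∈ stdSimplex ℝ A)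
    (hstep : ∀ t, p (t + 1) = mwuStep μ (p t) (k t)) (hk : ∀ t a b, k t a - k t b ≤ R)
    (T : ℕ) {a : A} (ha : 0 < p 0 a) :
    μ * ∑ t ∈ Finset.range T, (p t ⬝ᵥ k t - k t a)
      ≤ -Real.log (p 0 a) + T * (μ ^ 2 * R ^ 2 / 8) := by
  have hmem (t : ℕ) : p t ∈ stdSimplex ℝ A ∧ 0 < p t a := by
    induction t with
    | zero => exact ⟨hp, ha⟩
    | succ t ih =>
      rw [hstep]
      exact ⟨mwuStep_mem_stdSimplex ih.1 _ _, mwuStep_pos ih.1 _ _ ih.2⟩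
  have hlog : Real.log (p T a) ≤ 0 :=
    Real.log_nonpos (hmem T).2.le (mem_Icc_of_mem_stdSimplex (hmem T).1 a).2
  calc μ * ∑ t ∈ Finset.range T, (p t ⬝ᵥ k t - k t a)
      ≤ ∑ t ∈ Finset.range T,
          (Real.log (p (t + 1) a) - Real.log (p t a) + μ ^ 2 * R ^ 2 / 8) := by
        rw [Finset.mul_sum]
        refine Finset.sum_le_sum fun t _ => ?_
        rw [hstep]
        exact mul_dotProduct_sub_le_log_mwuStep (hmem t).1 (hk t) μ (hmem t).2
    _ = Real.log (p T a) - Real.log (p 0 a) + T * (μ ^ 2 * R ^ 2 / 8) := by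
        rw [Finset.sum_add_distrib, Finset.sum_range_sub fun t => Real.log (p t a),
          Finset.sum_const, Finset.card_range, nsmul_eq_mul]
    _ ≤ -Real.log (p 0 a) + T * (μ ^ 2 * R ^ 2 / 8) := by linarith

theorem le_of_mwuRate_mul_le {n T : ℕ} {R G : ℝ} (hn : 1 < n) (hT : 0 < T) (hR : 0 < R)
    (h : mwuRate n T R * G ≤ Real.log n + T * (mwuRate n T R ^ 2 * R ^ 2 / 8)) :
    G ≤ R * Real.sqrt (T * Real.log n / 2) := by
  have hT' : (0 : ℝ) < T := mod_cast hT
  have hlog : 0 < Real.log n := Real.log_pos (mod_cast hn)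
  set c := Real.sqrt (8 * Real.log n / T) with hc
  have hc_pos : 0 < c := Real.sqrt_pos.2 (by positivity)
  have hc_sq : T * c ^ 2 = 8 * Real.log n := by
    rw [hc, Real.sq_sqrt (by positivity)]
    field_simp
  have hsqrt : Real.sqrt (T * Real.log n / 2) = T * c / 4 := by
    rw [Real.sqrt_eq_iff_mul_self_eq (by positivity) (by positivity)]
    linear_combination (-(T : ℝ) / 16) * hc_sq
  rw [mwuRate, ← hc, div_pow, div_mul_cancel₀ _ (by positivity), div_mul_eq_mul_div,
    div_le_iff₀ hR] at h
  rw [hsqrt]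
  refine le_of_mul_le_mul_left (h.trans_eq ?_) hc_pos
  linear_combination (-R / 8) * hc_sq

theorem sum_mwu_regret_action_le {p k : ℕ → A → ℝ} {R : ℝ} {T : ℕ} (hR : 0 < R)
    (hp : ∀ a, p 0 a = 1 / Fintype.card A)
    (hstep : ∀ t, p (t + 1) = mwuStep (mwuRate (Fintype.card A) T R) (p t) (k t))
    (hk : ∀ t a b, k t a - k t b ≤ R) (a : A) :
    ∑ t ∈ Finset.range T, (p t ⬝ᵥ k t - k t a)
      ≤ R * Real.sqrt (T * Real.log (Fintype.card A) / 2) := by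
  have : Nonempty A := ⟨a⟩
  have hp₀ : p 0 ∈ stdSimplex ℝ A := ⟨fun b => by rw [hp]; positivity, by simp [hp]⟩
  rcases T.eq_zero_or_pos with rfl | hT
  · simp
  rcases subsingleton_or_nontrivial A with _ | _
  · have hmem (t : ℕ) : p t ∈ stdSimplex ℝ A := by
      induction t with
      | zero => exact hp₀
      | succ t ih => exact hstep t ▸ mwuStep_mem_stdSimplex ih _ _
    have hzero (t : ℕ) : p t ⬝ᵥ k t - k t a = 0 := by
      have hpt := hmem t
      rw [stdSimplex_unique, Set.mem_singleton_iff] at hpt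
      rw [hpt, dotProduct, Fintype.sum_subsingleton _ a, one_mul, sub_self]
    simp only [hzero, Finset.sum_const_zero]
    positivity
  · refine le_of_mwuRate_mul_le Fintype.one_lt_card hT hR ?_
    have h := mul_sum_mwu_regret_le hp₀ hstep hk T (a := a) (by rw [hp]; positivity)
    rwa [hp, one_div, Real.log_inv, neg_neg] at h

theorem sum_mwu_regret_le {p k : ℕ → A → ℝ} {R : ℝ} {T : ℕ} (hR : 0 < R)
    (hp : ∀ a, p 0 a = 1 / Fintype.card A)
    (hstep : ∀ t, p (t + 1) = mwuStep (mwuRate (Fintype.card A) T R) (p t) (k t))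
    (hk : ∀ t a b, k t a - k t b ≤ R) {q : A → ℝ} (hq : q ∈ stdSimplex ℝ A) :
    ∑ t ∈ Finset.range T, (p t ⬝ᵥ k t - q ⬝ᵥ k t)
      ≤ R * Real.sqrt (T * Real.log (Fintype.card A) / 2) := by
  have haverage : ∑ t ∈ Finset.range T, (p t ⬝ᵥ k t - q ⬝ᵥ k t)
      = ∑ a, q a * ∑ t ∈ Finset.range T, (p t ⬝ᵥ k t - k t a) := by
    simp_rw [Finset.mul_sum]
    rw [Finset.sum_comm]
    refine Finset.sum_congr rfl fun t _ => ?_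
    simp_rw [mul_sub, Finset.sum_sub_distrib, ← Finset.sum_mul, hq.2, one_mul, dotProduct]
  rw [haverage]
  exact (convex_Iic (R * Real.sqrt (T * Real.log (Fintype.card A) / 2))).sum_mem
    (fun a _ => hq.1 a) hq.2 fun a _ => sum_mwu_regret_action_le hR hp hstep hk a

end MultiplicativeWeights

section StochasticMatrix

variable {S : Type*} [Fintype S]

theorem l1Norm_sub_le (u v w : S → ℝ) : l1Norm (u - v) ≤ l1Norm (u - w) + l1Norm (v - w) := by
  simp only [l1Norm, ← Finset.sum_add_distrib, Pi.sub_apply]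
  refine Finset.sum_le_sum fun x _ => ?_
  rw [abs_sub_comm (v x)]
  exact abs_sub_le _ _ _

theorem l1Norm_sub_le_two {d d' : S → ℝ} (hd : d ∈ stdSimplex ℝ S) (hd' : d' ∈ stdSimplex ℝ S) :
    l1Norm (d - d') ≤ 2 := by
  calc l1Norm (d - d') ≤ ∑ x, (d x + d' x) := Finset.sum_le_sum fun x _ =>
        (abs_sub _ _).trans_eq (by rw [abs_of_nonneg (hd.1 x), abs_of_nonneg (hd'.1 x)])
    _ = 2 := by rw [Finset.sum_add_distrib, hd.2, hd'.2, one_add_one_eq_two]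

theorem dist_le_l1Norm_sub (u v : S → ℝ) : dist u v ≤ l1Norm (u - v) :=
  (dist_pi_le_iff (Finset.sum_nonneg fun _ _ => abs_nonneg _)).2 fun x =>
    Finset.single_le_sum (f := fun y => |(u - v) y|) (fun _ _ => abs_nonneg _) (Finset.mem_univ x)

theorem abs_dotProduct_le_of_sum_eq_zero {u m : S → ℝ} {α β : ℝ} (hu : ∑ x, u x = 0)
    (hm : ∀ x, m x ∈ Set.Icc α β) : |u ⬝ᵥ m| ≤ (β - α) / 2 * l1Norm u := by
  have hcenter : u ⬝ᵥ m = ∑ x, u x * (m x - (α + β) / 2) := by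
    simp_rw [mul_sub, Finset.sum_sub_distrib, ← Finset.sum_mul, hu, zero_mul, sub_zero, dotProduct]
  rw [hcenter, l1Norm, Finset.mul_sum]
  refine (Finset.abs_sum_le_sum_abs _ _).trans (Finset.sum_le_sum fun x _ => ?_)
  rw [abs_mul, mul_comm]
  refine mul_le_mul_of_nonneg_right (abs_le.2 ⟨?_, ?_⟩) (abs_nonneg _) <;>
    linarith [(hm x).1, (hm x).2]

variable [DecidableEq S]

theorem vecMul_mem_stdSimplex {P : Matrix S S ℝ} (hP : P ∈ rowStochastic ℝ S) {d : S → ℝ}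
    (hd : d ∈ stdSimplex ℝ S) : d ᵥ* P ∈ stdSimplex ℝ S := by
  refine ⟨nonneg_vecMul_of_mem_rowStochastic hP hd.1, ?_⟩
  rw [← dotProduct_one]
  exact vecMul_dotProduct_one_eq_one_rowStochastic hP (by rw [dotProduct_one, hd.2])

theorem vecMul_eq_self_of_tendsto {P : Matrix S S ℝ} {d ν : S → ℝ}
    (h : Tendsto (fun n : ℕ => d ᵥ* P ^ n) atTop (𝓝 ν)) : ν ᵥ* P = ν := by
  have hcont : Continuous fun e : S → ℝ => e ᵥ* P := by fun_prop
  refine tendsto_nhds_unique ((hcont.tendsto ν).comp h) (((tendsto_add_atTop_iff_nat 1).2 h).congr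
    fun n => ?_)
  rw [pow_succ, ← vecMul_vecMul, Function.comp_apply]

theorem mem_stdSimplex_of_tendsto {P : Matrix S S ℝ} (hP : P ∈ rowStochastic ℝ S) {d ν : S → ℝ}
    (hd : d ∈ stdSimplex ℝ S) (h : Tendsto (fun n : ℕ => d ᵥ* P ^ n) atTop (𝓝 ν)) :
    ν ∈ stdSimplex ℝ S :=
  (isClosed_stdSimplex ℝ S).mem_of_tendsto h
    (Eventually.of_forall fun n => vecMul_mem_stdSimplex (pow_mem hP n) hd)

/-- A Dobrushin contraction with factor `q`: a row-stochastic matrix that shrinks the `ℓ¹` distance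
between any two distributions by the factor `q ∈ [0, 1)`. This is the mixing condition for a single
Markov chain. -/
structure IsDobrushinContraction (q : ℝ) (P : Matrix S S ℝ) : Prop where
  mem_rowStochastic : P ∈ rowStochastic ℝ S
  nonneg : 0 ≤ q
  lt_one : q < 1
  l1Norm_vecMul_sub_le : ∀ d ∈ stdSimplex ℝ S, ∀ d' ∈ stdSimplex ℝ S,
    l1Norm (d ᵥ* P - d' ᵥ* P) ≤ q * l1Norm (d - d')

/-- The bias (relative value function) of a Markov chain with transition matrix `P`: the total
expected excess of the cost `m` over the constant `g`, as a function of the initial state. It is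
meant for `g` the stationary average of `m`, the only constant for which the series can converge
when the chain mixes. -/
noncomputable def bias (P : Matrix S S ℝ) (m : S → ℝ) (g : ℝ) (x : S) : ℝ :=
  ∑' n : ℕ, ((P ^ n *ᵥ m) x - g)

namespace IsDobrushinContraction

variable {q : ℝ} {P : Matrix S S ℝ}

theorem l1Norm_vecMul_pow_sub_le (h : IsDobrushinContraction q P) {d d' : S → ℝ}
    (hd : d ∈ stdSimplex ℝ S) (hd' : d' ∈ stdSimplex ℝ S) (n : ℕ) :
    l1Norm (d ᵥ* P ^ n - d' ᵥ* P ^ n) ≤ q ^ n * l1Norm (d - d') := by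
  induction n with
  | zero => simp
  | succ n ih =>
    have hPn := pow_mem h.mem_rowStochastic n
    rw [pow_succ, ← vecMul_vecMul, ← vecMul_vecMul, pow_succ', mul_assoc]
    exact (h.l1Norm_vecMul_sub_le _ (vecMul_mem_stdSimplex hPn hd) _
      (vecMul_mem_stdSimplex hPn hd')).trans (mul_le_mul_of_nonneg_left ih h.nonneg)

theorem exists_tendsto_vecMul_pow (h : IsDobrushinContraction q P) {d : S → ℝ}
    (hd : d ∈ stdSimplex ℝ S) : ∃ ν, Tendsto (fun n : ℕ => d ᵥ* P ^ n) atTop (𝓝 ν) := by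
  refine cauchySeq_tendsto_of_complete (cauchySeq_of_le_geometric q 2 h.lt_one fun n => ?_)
  have hdP := vecMul_mem_stdSimplex h.mem_rowStochastic hd
  calc dist (d ᵥ* P ^ n) (d ᵥ* P ^ (n + 1))
      ≤ l1Norm (d ᵥ* P ^ n - (d ᵥ* P) ᵥ* P ^ n) := by
        rw [vecMul_vecMul, ← pow_succ']
        exact dist_le_l1Norm_sub _ _
    _ ≤ q ^ n * l1Norm (d - d ᵥ* P) := h.l1Norm_vecMul_pow_sub_le hd hdP n
    _ ≤ 2 * q ^ n := by
        rw [mul_comm]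
        exact mul_le_mul_of_nonneg_right (l1Norm_sub_le_two hd hdP) (pow_nonneg h.nonneg n)

theorem abs_vecMul_pow_dotProduct_sub_le (h : IsDobrushinContraction q P) {d d' m : S → ℝ}
    {α β : ℝ} (hd : d ∈ stdSimplex ℝ S) (hd' : d' ∈ stdSimplex ℝ S)
    (hm : ∀ x, m x ∈ Set.Icc α β) (n : ℕ) :
    |(d ᵥ* P ^ n) ⬝ᵥ m - (d' ᵥ* P ^ n) ⬝ᵥ m| ≤ (β - α) / 2 * l1Norm (d - d') * q ^ n := by
  have hPn := pow_mem h.mem_rowStochastic n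
  obtain ⟨x⟩ : Nonempty S := by
    by_contra hS
    rw [not_nonempty_iff] at hS
    simpa using hd.2
  have hαβ : α ≤ β := (hm x).1.trans (hm x).2
  rw [← sub_dotProduct, mul_assoc, mul_comm (l1Norm _)]
  refine (abs_dotProduct_le_of_sum_eq_zero ?_ hm).trans
    (mul_le_mul_of_nonneg_left (h.l1Norm_vecMul_pow_sub_le hd hd' n) (by linarith))
  simp_rw [Pi.sub_apply, Finset.sum_sub_distrib, (vecMul_mem_stdSimplex hPn hd).2,
    (vecMul_mem_stdSimplex hPn hd').2, sub_self]

variable {ν : S → ℝ}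

theorem summable_vecMul_pow_dotProduct_sub (h : IsDobrushinContraction q P)
    (hν : ν ∈ stdSimplex ℝ S) (hinv : ν ᵥ* P = ν) (m : S → ℝ) {d : S → ℝ}
    (hd : d ∈ stdSimplex ℝ S) : Summable fun n : ℕ => (d ᵥ* P ^ n) ⬝ᵥ m - ν ⬝ᵥ m := by
  have hinv_pow (n : ℕ) : ν ᵥ* P ^ n = ν := by
    induction n with
    | zero => simp
    | succ n ih => rw [pow_succ, ← vecMul_vecMul, ih, hinv]
  refine .of_norm_bounded (g := fun n => (‖m‖ - -‖m‖) / 2 * l1Norm (d - ν) * q ^ n)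
    ((summable_geometric_of_lt_one h.nonneg h.lt_one).mul_left _) fun n => ?_
  have hbound := h.abs_vecMul_pow_dotProduct_sub_le hd hν
    (fun x => abs_le.1 (norm_le_pi_norm m x)) n
  rwa [hinv_pow] at hbound

theorem hasSum_dotProduct_bias (h : IsDobrushinContraction q P) (hν : ν ∈ stdSimplex ℝ S)
    (hinv : ν ᵥ* P = ν) (m : S → ℝ) {d : S → ℝ} (hd : d ∈ stdSimplex ℝ S) :
    HasSum (fun n : ℕ => (d ᵥ* P ^ n) ⬝ᵥ m - ν ⬝ᵥ m) (d ⬝ᵥ bias P m (ν ⬝ᵥ m)) := by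
  have hstate (x : S) : HasSum (fun n : ℕ => (P ^ n *ᵥ m) x - ν ⬝ᵥ m) (bias P m (ν ⬝ᵥ m) x) := by
    refine Summable.hasSum ((h.summable_vecMul_pow_dotProduct_sub hν hinv m
      (single_mem_stdSimplex ℝ x)).congr fun n => ?_)
    rw [← dotProduct_mulVec, single_one_dotProduct]
  have haverage (n : ℕ) :
      (d ᵥ* P ^ n) ⬝ᵥ m - ν ⬝ᵥ m = ∑ x, d x * ((P ^ n *ᵥ m) x - ν ⬝ᵥ m) := by
    simp_rw [mul_sub, Finset.sum_sub_distrib, ← Finset.sum_mul, hd.2, one_mul, ← dotProduct_mulVec]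
    rfl
  simp only [haverage]
  exact hasSum_sum fun x _ => (hstate x).mul_left (d x)

theorem bias_eq (h : IsDobrushinContraction q P) (hν : ν ∈ stdSimplex ℝ S) (hinv : ν ᵥ* P = ν)
    (m : S → ℝ) (x : S) :
    bias P m (ν ⬝ᵥ m) x = m x - ν ⬝ᵥ m + (P *ᵥ bias P m (ν ⬝ᵥ m)) x := by
  have hx := single_mem_stdSimplex ℝ x
  have hstart := h.hasSum_dotProduct_bias hν hinv m hx
  have hnext := h.hasSum_dotProduct_bias hν hinv m (vecMul_mem_stdSimplex h.mem_rowStochastic hx)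
  have hshift := hstart.summable.tsum_eq_zero_add
  simp_rw [pow_succ', ← vecMul_vecMul] at hshift
  rw [hstart.tsum_eq, hnext.tsum_eq, pow_zero, vecMul_one, ← dotProduct_mulVec] at hshift
  simpa only [single_one_dotProduct] using hshift

theorem dotProduct_bias_sub_le (h : IsDobrushinContraction q P) (hν : ν ∈ stdSimplex ℝ S)
    (hinv : ν ᵥ* P = ν) {d d' m : S → ℝ} {α β : ℝ} (hd : d ∈ stdSimplex ℝ S)
    (hd' : d' ∈ stdSimplex ℝ S) (hm : ∀ x, m x ∈ Set.Icc α β) :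
    d ⬝ᵥ bias P m (ν ⬝ᵥ m) - d' ⬝ᵥ bias P m (ν ⬝ᵥ m)
      ≤ (β - α) / 2 * l1Norm (d - d') * (1 - q)⁻¹ := by
  refine hasSum_le (fun n => ?_)
    ((h.hasSum_dotProduct_bias hν hinv m hd).sub (h.hasSum_dotProduct_bias hν hinv m hd'))
    ((hasSum_geometric_of_lt_one h.nonneg h.lt_one).mul_left _)
  rw [sub_sub_sub_cancel_right]
  exact (le_abs_self _).trans (h.abs_vecMul_pow_dotProduct_sub_le hd hd' hm n)

end IsDobrushinContraction

end StochasticMatrix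

section MixingRate

theorem exp_neg_one_div_lt_one {τ : ℝ} (hτ : 0 < τ) : Real.exp (-1 / τ) < 1 := by
  rw [Real.exp_lt_one_iff]
  exact div_neg_of_neg_of_pos neg_one_lt_zero hτ

theorem one_add_exp_div_one_sub_exp_le {τ : ℝ} (hτ : 1 / 2 ≤ τ) :
    (1 + Real.exp (-1 / τ)) / (1 - Real.exp (-1 / τ)) ≤ 3 * τ := by
  have hτ₀ : 0 < τ := by linarith
  set x := 1 / τ with hx
  have hx₀ : 0 < x := by positivity
  have hx₂ : x ≤ 2 := by
    rw [hx, div_le_iff₀ hτ₀]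
    linarith
  have hq : Real.exp (-1 / τ) = (Real.exp x)⁻¹ := by rw [← Real.exp_neg, neg_div]
  have hlt : 1 < Real.exp x := Real.one_lt_exp_iff.2 hx₀
  -- `(3 - x) * (1 + x + x ^ 2 / 2) - (3 + x) = x * (2 - x) * (1 + x) / 2`
  have hexp : 3 + x ≤ (3 - x) * Real.exp x := by
    have hquad := mul_le_mul_of_nonneg_left (Real.quadratic_le_exp_of_nonneg hx₀.le)
      (by linarith : 0 ≤ 3 - x)
    have hcubic : 0 ≤ x * (2 - x) * (1 + x) :=
      mul_nonneg (mul_nonneg hx₀.le (by linarith)) (by linarith)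
    linarith
  calc (1 + Real.exp (-1 / τ)) / (1 - Real.exp (-1 / τ))
      = (Real.exp x + 1) / (Real.exp x - 1) := by
        rw [hq, ← mul_div_mul_left _ _ (Real.exp_pos x).ne', mul_add, mul_sub, mul_one,
          mul_inv_cancel₀ (Real.exp_pos x).ne']
    _ ≤ 3 / x := by
        rw [div_le_div_iff₀ (sub_pos.2 hlt) hx₀]
        linarith
    _ = 3 * τ := by
        rw [hx]
        field_simp

end MixingRate

section Policies

variable {S A : Type*} [Fintype A]

/-- The expected loss of the next action of `π`, as a function of the current state. -/
def Policy.stateLoss (π : Policy S A) (l : S → A → ℝ) (x : S) : ℝ := π.prob x ⬝ᵥ l x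

theorem Policy.stateLoss_mem {C : Set ℝ} (hC : Convex ℝ C) (π : Policy S A) {l : S → A → ℝ}
    (hl : ∀ x a, l x a ∈ C) (x : S) : π.stateLoss l x ∈ C :=
  hC.sum_mem (fun a _ => (π.prob_mem x).1 a) (π.prob_mem x).2 fun a _ => hl x a

/-- The policy that chooses the action `f x` in state `x`. Its transition matrix exhibits rows
`P(· | x, a)` with prescribed actions, to which mixing then applies. -/
def Policy.deterministic [DecidableEq A] (f : S → A) : Policy S A :=
  ⟨fun x => Pi.single (f x) 1, fun _ => single_mem_stdSimplex ℝ _⟩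

theorem pairing_mul_prob [Fintype S] (l : S → A → ℝ) (π : Policy S A) (d : S → ℝ) :
    pairing l (fun x a => d x * π.prob x a) = d ⬝ᵥ π.stateLoss l := by
  simp only [pairing, Policy.stateLoss, dotProduct, Finset.mul_sum]
  exact Finset.sum_congr rfl fun x _ => Finset.sum_congr rfl fun a _ => by ring

theorem pairing_ite [Fintype S] (l : S → A → ℝ) (s : S) (a : A)
    [∀ x b, Decidable (x = s ∧ b = a)] :
    pairing l (fun x b => if x = s ∧ b = a then 1 else 0) = l s a := by
  rw [pairing, Fintype.sum_eq_single s fun x hx => by simp [hx],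
    Fintype.sum_eq_single a fun b hb => by simp [hb]]
  simp

end Policies

namespace MDP

variable {S A : Type*} [Fintype S] [Fintype A] {M : MDP S A}

theorem transMatrix_mem_rowStochastic [DecidableEq S] (M : MDP S A) (π : Policy S A) :
    M.transMatrix π ∈ rowStochastic ℝ S := by
  refine mem_rowStochastic_iff_sum.2 ⟨fun x x' => Finset.sum_nonneg fun a _ =>
    mul_nonneg ((π.prob_mem x).1 a) ((M.trans_mem x a).1 x'), fun x => ?_⟩
  simp only [transMatrix, of_apply]
  rw [Finset.sum_comm]
  simp_rw [← Finset.mul_sum, (M.trans_mem x _).2, mul_one]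
  exact (π.prob_mem x).2

theorem transMatrix_mulVec (M : MDP S A) (π : Policy S A) (f : S → ℝ) (x : S) :
    (M.transMatrix π *ᵥ f) x = π.prob x ⬝ᵥ fun a => M.trans x a ⬝ᵥ f := by
  simp only [mulVec, dotProduct, transMatrix, of_apply, Finset.sum_mul, Finset.mul_sum, mul_assoc]
  rw [Finset.sum_comm]

theorem transMatrix_deterministic [DecidableEq A] (M : MDP S A) (f : S → A) (x : S) :
    (M.transMatrix (.deterministic f)).row x = M.trans x (f x) := by
  funext x'
  simp [row, transMatrix, Policy.deterministic, Pi.single_apply]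

theorem Mixing.isDobrushinContraction [DecidableEq S] {τ : ℝ} (hmix : M.Mixing τ) (hτ : 0 < τ)
    (π : Policy S A) : IsDobrushinContraction (Real.exp (-1 / τ)) (M.transMatrix π) where
  mem_rowStochastic := M.transMatrix_mem_rowStochastic π
  nonneg := (Real.exp_pos _).le
  lt_one := exp_neg_one_div_lt_one hτ
  l1Norm_vecMul_sub_le d hd d' hd' := hmix d hd d' hd' π

theorem law_succ (M : MDP S A) (π : Policy S A) (v : S → A → ℝ) (n : ℕ) :
    M.law π v (n + 1) = M.law π (M.law π v 1) n := by
  induction n with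
  | zero => rfl
  | succ n ih => rw [law, ih]; rfl

theorem law_mul_prob [DecidableEq S] (M : MDP S A) (π : Policy S A) (d : S → ℝ) (n : ℕ) :
    M.law π (fun x a => d x * π.prob x a) n
      = fun x a => (d ᵥ* M.transMatrix π ^ n) x * π.prob x a := by
  induction n with
  | zero => simp [law]
  | succ n ih =>
    rw [law, ih, pow_succ, ← vecMul_vecMul]
    simp only [vecMul, dotProduct, transMatrix, of_apply, Finset.mul_sum, mul_assoc]

theorem law_ite_one (M : MDP S A) (π : Policy S A) (s : S) (a : A)
    [∀ x b, Decidable (x = s ∧ b = a)] :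
    M.law π (fun x b => if x = s ∧ b = a then 1 else 0) 1
      = fun x b => M.trans s a x * π.prob x b := by
  funext x b
  simp only [law]
  rw [Fintype.sum_eq_single s fun y hy => by simp [hy],
    Fintype.sum_eq_single a fun c hc => by simp [hc]]
  simp

/-- The stationary state distribution of a policy, as the state marginal of `d_π`. -/
noncomputable def stateDist (M : MDP S A) (π : Policy S A) (x : S) : ℝ := ∑ a, M.stationary π x a

theorem stationary_eq_of_tendsto [DecidableEq S] {π : Policy S A} {ν : S → ℝ}
    (h : Tendsto (fun n : ℕ => M.init ᵥ* M.transMatrix π ^ n) atTop (𝓝 ν)) :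
    M.stationary π = fun x a => ν x * π.prob x a := by
  funext x a
  refine Tendsto.limUnder_eq ?_
  simp only [occupancy, law_mul_prob]
  exact (tendsto_pi_nhds.1 h x).mul_const _

theorem stateDist_eq_of_tendsto [DecidableEq S] {π : Policy S A} {ν : S → ℝ}
    (h : Tendsto (fun n : ℕ => M.init ᵥ* M.transMatrix π ^ n) atTop (𝓝 ν)) :
    M.stateDist π = ν := by
  funext x
  simp only [stateDist, stationary_eq_of_tendsto h, ← Finset.mul_sum, (π.prob_mem x).2, mul_one]

theorem Mixing.tendsto_stateDist [DecidableEq S] {τ : ℝ} (hmix : M.Mixing τ) (hτ : 0 < τ)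
    (π : Policy S A) :
    Tendsto (fun n : ℕ => M.init ᵥ* M.transMatrix π ^ n) atTop (𝓝 (M.stateDist π)) := by
  obtain ⟨ν, hν⟩ := (hmix.isDobrushinContraction hτ π).exists_tendsto_vecMul_pow M.init_mem
  rwa [stateDist_eq_of_tendsto hν]

theorem Mixing.stateDist_mem_stdSimplex {τ : ℝ} (hmix : M.Mixing τ) (hτ : 0 < τ)
    (π : Policy S A) : M.stateDist π ∈ stdSimplex ℝ S := by
  classical
  exact mem_stdSimplex_of_tendsto (M.transMatrix_mem_rowStochastic π) M.init_mem
    (hmix.tendsto_stateDist hτ π)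

theorem Mixing.stateDist_vecMul {τ : ℝ} (hmix : M.Mixing τ) (hτ : 0 < τ) (π : Policy S A) :
    M.stateDist π ᵥ* M.transMatrix π = M.stateDist π := by
  classical
  exact vecMul_eq_self_of_tendsto (hmix.tendsto_stateDist hτ π)

theorem Mixing.avgLoss_eq {τ : ℝ} (hmix : M.Mixing τ) (hτ : 0 < τ) (π : Policy S A)
    (l : S → A → ℝ) : M.avgLoss π l = M.stateDist π ⬝ᵥ π.stateLoss l := by
  classical
  rw [avgLoss, stationary_eq_of_tendsto (hmix.tendsto_stateDist hτ π), pairing_mul_prob]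

/-- The bias of the Markov chain of `π` with the losses `l`: the total expected excess of the loss
over its stationary average, as a function of the initial state. -/
noncomputable def policyBias [DecidableEq S] (M : MDP S A) (π : Policy S A) (l : S → A → ℝ) :
    S → ℝ :=
  bias (M.transMatrix π) (π.stateLoss l) (M.avgLoss π l)

theorem pairing_law_ite [DecidableEq S] (M : MDP S A) (π : Policy S A) (l : S → A → ℝ) (s : S)
    (a : A) [∀ x b, Decidable (x = s ∧ b = a)] (n : ℕ) :
    pairing l (M.law π (fun x b => if x = s ∧ b = a then 1 else 0) (n + 1))
      = (M.trans s a ᵥ* M.transMatrix π ^ n) ⬝ᵥ π.stateLoss l := by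
  rw [law_succ, law_ite_one, law_mul_prob, pairing_mul_prob]

theorem Mixing.Q_eq [DecidableEq S] {τ : ℝ} (hmix : M.Mixing τ) (hτ : 0 < τ) (π : Policy S A)
    (l : S → A → ℝ) (s : S) (a : A) :
    M.Q π l s a = l s a - M.avgLoss π l + M.trans s a ⬝ᵥ M.policyBias π l := by
  have hη := hmix.avgLoss_eq hτ π l
  have hsum := (hmix.isDobrushinContraction hτ π).hasSum_dotProduct_bias
    (hmix.stateDist_mem_stdSimplex hτ π) (hmix.stateDist_vecMul hτ π) (π.stateLoss l)
    (M.trans_mem s a)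
  rw [← hη] at hsum
  rw [Q, Summable.tsum_eq_zero_add ((summable_nat_add_iff 1).1
    (by simpa only [pairing_law_ite] using hsum.summable))]
  simp only [pairing_law_ite, hsum.tsum_eq, policyBias]
  rw [law, pairing_ite]

theorem Mixing.dotProduct_Q_eq [DecidableEq S] {τ : ℝ} (hmix : M.Mixing τ) (hτ : 0 < τ)
    (π ρ : Policy S A) (l : S → A → ℝ) (s : S) :
    ρ.prob s ⬝ᵥ M.Q π l s
      = ρ.stateLoss l s - M.avgLoss π l + (M.transMatrix ρ *ᵥ M.policyBias π l) s := by
  rw [transMatrix_mulVec, Policy.stateLoss]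
  simp only [dotProduct, hmix.Q_eq hτ, mul_add, mul_sub, Finset.sum_add_distrib,
    Finset.sum_sub_distrib, ← Finset.sum_mul, (ρ.prob_mem s).2, one_mul]

theorem Mixing.dotProduct_Q_eq_policyBias [DecidableEq S] {τ : ℝ} (hmix : M.Mixing τ) (hτ : 0 < τ)
    (π : Policy S A) (l : S → A → ℝ) (s : S) :
    π.prob s ⬝ᵥ M.Q π l s = M.policyBias π l s := by
  rw [hmix.dotProduct_Q_eq hτ, policyBias, hmix.avgLoss_eq hτ]
  exact ((hmix.isDobrushinContraction hτ π).bias_eq (hmix.stateDist_mem_stdSimplex hτ π)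
    (hmix.stateDist_vecMul hτ π) _ s).symm

theorem Mixing.avgLoss_sub_avgLoss {τ : ℝ} (hmix : M.Mixing τ) (hτ : 0 < τ) (π π' : Policy S A)
    (l : S → A → ℝ) :
    M.avgLoss π l - M.avgLoss π' l
      = ∑ s, M.stateDist π' s * (π.prob s ⬝ᵥ M.Q π l s - π'.prob s ⬝ᵥ M.Q π l s) := by
  classical
  have hinv : M.stateDist π' ⬝ᵥ (M.transMatrix π' *ᵥ M.policyBias π l)
      = M.stateDist π' ⬝ᵥ M.policyBias π l := by
    rw [dotProduct_mulVec, hmix.stateDist_vecMul hτ]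
  symm
  calc ∑ s, M.stateDist π' s * (π.prob s ⬝ᵥ M.Q π l s - π'.prob s ⬝ᵥ M.Q π l s)
      = ∑ s, M.stateDist π' s * (M.policyBias π l s - (π'.stateLoss l s - M.avgLoss π l
          + (M.transMatrix π' *ᵥ M.policyBias π l) s)) := by
        simp only [hmix.dotProduct_Q_eq_policyBias hτ, hmix.dotProduct_Q_eq hτ π π']
    _ = M.stateDist π' ⬝ᵥ M.policyBias π l - (M.stateDist π' ⬝ᵥ π'.stateLoss l - M.avgLoss π l
          + M.stateDist π' ⬝ᵥ (M.transMatrix π' *ᵥ M.policyBias π l)) := by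
        simp only [dotProduct, mul_sub, mul_add, Finset.sum_sub_distrib, Finset.sum_add_distrib,
          ← Finset.sum_mul, (hmix.stateDist_mem_stdSimplex hτ π').2, one_mul]
    _ = M.avgLoss π l - M.avgLoss π' l := by
        rw [hinv, hmix.avgLoss_eq hτ π' l]
        ring

theorem Mixing.l1Norm_trans_sub_trans_of_ne_le {τ : ℝ} (hmix : M.Mixing τ) {s s' : S}
    (hs : s ≠ s') (a b : A) :
    l1Norm (M.trans s a - M.trans s' b) ≤ 2 * Real.exp (-1 / τ) := by
  classical
  have hs_mem := single_mem_stdSimplex ℝ s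
  have hs'_mem := single_mem_stdSimplex ℝ s'
  have h := hmix _ hs_mem _ hs'_mem (.deterministic fun x => if x = s then a else b)
  rw [single_one_vecMul, single_one_vecMul, transMatrix_deterministic,
    transMatrix_deterministic, if_pos rfl, if_neg hs.symm] at h
  rw [mul_comm]
  exact h.trans (mul_le_mul_of_nonneg_left (l1Norm_sub_le_two hs_mem hs'_mem) (Real.exp_pos _).le)

theorem Mixing.l1Norm_trans_sub_trans_le {τ : ℝ} (hmix : M.Mixing τ) (s : S) (a b : A) :
    l1Norm (M.trans s a - M.trans s b) ≤ 4 * Real.exp (-1 / τ) := by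
  rcases subsingleton_or_nontrivial S with _ | _
  · have : Unique S := uniqueOfSubsingleton s
    have ha := M.trans_mem s a
    have hb := M.trans_mem s b
    rw [stdSimplex_unique, Set.mem_singleton_iff] at ha hb
    simp only [ha, hb, sub_self, l1Norm, Pi.zero_apply, abs_zero, Finset.sum_const_zero]
    positivity
  · obtain ⟨s', hs'⟩ := exists_ne s
    linarith [l1Norm_sub_le (M.trans s a) (M.trans s b) (M.trans s' a),
      hmix.l1Norm_trans_sub_trans_of_ne_le hs'.symm a a,
      hmix.l1Norm_trans_sub_trans_of_ne_le hs'.symm b a]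

theorem Mixing.Q_sub_Q_le {τ : ℝ} (hmix : M.Mixing τ) (hτ : 0 < τ) (π : Policy S A)
    {l : S → A → ℝ} {α β : ℝ} (hl : ∀ x a, l x a ∈ Set.Icc α β) (s : S) (a b : A) :
    M.Q π l s a - M.Q π l s b
      ≤ (β - α) * ((1 + Real.exp (-1 / τ)) / (1 - Real.exp (-1 / τ))) := by
  classical
  set q := Real.exp (-1 / τ)
  have hP : IsDobrushinContraction q (M.transMatrix π) := hmix.isDobrushinContraction hτ π
  have hq : 0 < 1 - q := sub_pos.2 hP.lt_one
  have hαβ : 0 ≤ β - α := sub_nonneg.2 ((hl s a).1.trans (hl s a).2)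
  have hbias : M.trans s a ⬝ᵥ M.policyBias π l - M.trans s b ⬝ᵥ M.policyBias π l
      ≤ (β - α) / 2 * (4 * q) * (1 - q)⁻¹ := by
    rw [policyBias, hmix.avgLoss_eq hτ]
    refine (hP.dotProduct_bias_sub_le (hmix.stateDist_mem_stdSimplex hτ π)
      (hmix.stateDist_vecMul hτ π) (M.trans_mem s a) (M.trans_mem s b)
      (π.stateLoss_mem (convex_Icc α β) hl)).trans ?_
    gcongr
    exact hmix.l1Norm_trans_sub_trans_le s a b
  calc M.Q π l s a - M.Q π l s b
      = l s a - l s b + (M.trans s a ⬝ᵥ M.policyBias π l - M.trans s b ⬝ᵥ M.policyBias π l) := by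
        rw [hmix.Q_eq hτ, hmix.Q_eq hτ]
        ring
    _ ≤ (β - α) + (β - α) / 2 * (4 * q) * (1 - q)⁻¹ := by linarith [(hl s a).2, (hl s b).1]
    _ = (β - α) * ((1 + q) / (1 - q)) := by
        field_simp
        ring

theorem Mixing.sum_avgLoss_sub_le {τ : ℝ} (hmix : M.Mixing τ) (hτ : 0 < τ) {R : ℝ} (hR : 0 < R)
    {T : ℕ} {l : ℕ → S → A → ℝ} {πs : ℕ → Policy S A}
    (huniform : ∀ s a, (πs 0).prob s a = 1 / Fintype.card A)
    (hstep : ∀ t s, (πs (t + 1)).prob s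
      = mwuStep (mwuRate (Fintype.card A) T R) ((πs t).prob s) (M.Q (πs t) (l t) s))
    (hrange : ∀ t s a b, M.Q (πs t) (l t) s a - M.Q (πs t) (l t) s b ≤ R) (π : Policy S A) :
    ∑ t ∈ Finset.range T, (M.avgLoss (πs t) (l t) - M.avgLoss π (l t))
      ≤ R * Real.sqrt (T * Real.log (Fintype.card A) / 2) := by
  have hν := hmix.stateDist_mem_stdSimplex hτ π
  simp_rw [hmix.avgLoss_sub_avgLoss hτ]
  rw [Finset.sum_comm]
  simp_rw [← Finset.mul_sum]
  exact (convex_Iic (R * Real.sqrt (T * Real.log (Fintype.card A) / 2))).sum_mem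
    (fun s _ => hν.1 s) hν.2 fun s _ => sum_mwu_regret_le hR (huniform s) (fun t => hstep t s)
      (fun t => hrange t s) (π.prob_mem s)

end MDP

section Adversary

variable {S A : Type*} {L : ℕ} {ℓ : Fin L → S → A → ℝ}

theorem mem_of_mem_lossSimplex {C : Set ℝ} (hC : Convex ℝ C) (hℓ : ∀ i x a, ℓ i x a ∈ C)
    {l : S → A → ℝ} (hl : l ∈ lossSimplex ℓ) (x : S) (a : A) : l x a ∈ C := by
  obtain ⟨w, hw, rfl⟩ := hl
  exact hC.sum_mem (fun i _ => hw.1 i) hw.2 fun i _ => hℓ i x a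

theorem Adversary.NoExternalRegret.sum_pairing_sub_le [Fintype S] [Fintype A] {adv : Adversary ℓ}
    {M : MDP S A} {T : ℕ} (hadv : adv.NoExternalRegret M T) {l : ℕ → S → A → ℝ}
    (hl : ∀ t, l t ∈ lossSimplex ℓ) (π : Policy S A) :
    ∑ t ∈ Finset.range T, pairing (l t) (M.stationary π)
        - ∑ t ∈ Finset.range T, pairing (adv.loss (fun _ => π) t) (M.stationary π)
      ≤ Real.sqrt (T * Real.log L / 2) := by
  rcases T.eq_zero_or_pos with rfl | hT
  · simp
  set G := ∑ t ∈ Finset.range T, pairing (adv.loss (fun _ => π) t) (M.stationary π)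
  have hT' : (0 : ℝ) < T := mod_cast hT
  have hround (t : ℕ) :
      pairing (l t) (M.stationary π) ≤ (Real.sqrt (T * Real.log L / 2) + G) / T := by
    have h := hadv (fun _ => π) (l t) (hl t)
    rw [Finset.sum_const, Finset.card_range, nsmul_eq_mul] at h
    rw [le_div_iff₀' hT']
    linarith
  have hsum := Finset.sum_le_card_nsmul (Finset.range T) _ _ fun t _ => hround t
  rw [Finset.card_range, nsmul_eq_mul, mul_div_cancel₀ _ hT'.ne'] at hsum
  linarith

end Adversary

end OMDP

theorem mainTheorem2_general {S A : Type*} [Fintype S] [Fintype A] (M : OMDP.MDP S A)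
    {τ R : ℝ} (hτ : 0 < τ) (hR : (1 + Real.exp (-1 / τ)) / (1 - Real.exp (-1 / τ)) ≤ R)
    (hmix : M.Mixing τ)
    {L : ℕ} (ℓ : Fin L → S → A → ℝ) (hℓ : ∀ i x a, ℓ i x a ∈ Set.Icc (0 : ℝ) 1)
    (T : ℕ) (adv : OMDP.Adversary ℓ) (hadv : adv.NoExternalRegret M T)
    (πs : ℕ → OMDP.Policy S A)
    (hπs : OMDP.FollowsMDPE M adv (OMDP.mwuRate (Fintype.card A) T R) πs)
    (π : OMDP.Policy S A) :
    ∑ t ∈ Finset.range T, OMDP.pairing (adv.loss πs t) (M.stationary (πs t))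
        - ∑ t ∈ Finset.range T, OMDP.pairing (adv.loss (fun _ => π) t) (M.stationary π)
      ≤ Real.sqrt (T * Real.log L / 2) + R * Real.sqrt (T * Real.log (Fintype.card A) / 2) := by
  have hR_pos : 0 < R :=
    (div_pos (by positivity) (sub_pos.2 (OMDP.exp_neg_one_div_lt_one hτ))).trans_le hR
  have hmem (t : ℕ) : adv.loss πs t ∈ OMDP.lossSimplex ℓ := adv.respond_mem t _
  have hrange (t : ℕ) (s : S) (a b : A) :
      M.Q (πs t) (adv.loss πs t) s a - M.Q (πs t) (adv.loss πs t) s b ≤ R := by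
    refine (hmix.Q_sub_Q_le hτ (πs t)
      (OMDP.mem_of_mem_lossSimplex (convex_Icc 0 1) hℓ (hmem t)) s a b).trans ?_
    rwa [sub_zero, one_mul]
  have hagent := hmix.sum_avgLoss_sub_le hτ hR_pos hπs.1 hπs.2 hrange π
  have hadversary := hadv.sum_pairing_sub_le hmem π
  simp only [OMDP.MDP.avgLoss, Finset.sum_sub_distrib] at hagent
  linarith

/-- The policies `πs` are those of MDP-Expert; the comparator `π` is any stationary policy, and
the adversary's losses against it are those it plays when the agent uses `π` in all rounds. -/
theorem mainTheorem2 {S A : Type*} [Fintype S] [Fintype A] (M : OMDP.MDP S A)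
    (τ : ℝ) (hτ : 1 / 2 ≤ τ) (hmix : M.Mixing τ)
    {L : ℕ} (ℓ : Fin L → S → A → ℝ) (hℓ : ∀ i x a, ℓ i x a ∈ Set.Icc (0 : ℝ) 1)
    (T : ℕ) (adv : OMDP.Adversary ℓ) (hadv : adv.NoExternalRegret M T)
    (πs : ℕ → OMDP.Policy S A)
    (hπs : OMDP.FollowsMDPE M adv (OMDP.mwuRate (Fintype.card A) T (3 * τ)) πs)
    (π : OMDP.Policy S A) :
    ∑ t ∈ Finset.range T, OMDP.pairing (adv.loss πs t) (M.stationary (πs t))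
        - ∑ t ∈ Finset.range T, OMDP.pairing (adv.loss (fun _ => π) t) (M.stationary π)
      ≤ Real.sqrt (T * Real.log L / 2)
        + 3 * τ * Real.sqrt (T * Real.log (Fintype.card A) / 2) :=
  mainTheorem2_general M (by linarith) (OMDP.one_add_exp_div_one_sub_exp_le hτ) hmix ℓ hℓ T adv hadv
    πs hπs π
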